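/- Let $K$ be a field of characteristic zero, let $k\ge 0$ and $n_1,\dots,n_k\ge 1$ be integers, put $s_j=n_1+\dots+n_{j-1}$ for $1\le j\le k$ (so $s_1=0$) and $n=1+n_1+\dots+n_k$. Let $N$ be the model nilpotent Lie algebra with basis $e_1,\dots,e_n$ and non-zero products $$[e_{s_j+i},e_1]=e_{s_j+i+1},\qquad 1\le j\le k,\ 2\le i\le n_j$$ (when $n_1\ge\dots\ge n_k$, its characteristic sequence is $(n_1,\dots,n_k,1)$). Let $L_{k+1}(N)$ be the solvable Lie algebra over $K$ with nilradical $N$ and complementary space of dimension $k+1$ given by a basis $x_1,\dots,x_{k+1},e_1,\dots,e_n$ and the products $$[e_{s_j+i},e_1]=e_{s_j+i+1}\quad(1\le j\le k,\ 2\le i\le n_j),$$ $$[e_m,x_1]=m\,e_m\quad(1\le m\le n),$$ $$[e_{s_j+i},x_{j+1}]=e_{s_j+i}\quad(1\le j\le k,\ 2\le i\le n_j+1),$$ all other products of basis vectors being zero, up to antisymmetry. A linear operator $\Delta$ on a Lie algebra $L$ is called a local derivation if for every $x\in L$ there is a derivation $d_x$ of $L$ with $\Delta(x)=d_x(x)$.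 Then every local derivation $\Delta$ of $L_{k+1}(N)$ is a derivation; moreover it is inner: there is $z\in L_{k+1}(N)$ such that $\Delta(y)=[y,z]$ for all $y\in L_{k+1}(N)$. -/

import Mathlib

namespace ModelSolvable

open Module

/-- Labels of the basis `x_1, …, x_{k+1}, e_1, …, e_n`, where `n = 1 + n_1 + … + n_k`.
The left summand labels the `x`'s (`x_1` by `0`, and `x_{j+1}` by `j.succ`); `none` labels `e_1`;
and `some ⟨j, i⟩` labels the `i`-th vector of the `j`-th Jordan block (with `i = 0, …, n_j - 1`),
that is `e_m` with `m = pos n j i`. -/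
abbrev Idx {k : ℕ} (n : Fin k → ℕ) : Type :=
  Fin (k + 1) ⊕ Option (Σ j : Fin k, Fin (n j))

/-- The label of `x_{j+1}`, `j = 0, …, k`. -/
abbrev xi {k : ℕ} (n : Fin k → ℕ) (j : Fin (k + 1)) : Idx n := Sum.inl j

/-- The label of `e_1`. -/
abbrev e₁ {k : ℕ} (n : Fin k → ℕ) : Idx n := Sum.inr none

/-- The label of the `i`-th vector of block `j` (both counted from `0`). -/
abbrev ei {k : ℕ} (n : Fin k → ℕ) (j : Fin k) (i : Fin (n j)) : Idx n := Sum.inr (some ⟨j, i⟩)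

/-- The number `m` such that the `i`-th vector of block `j` is `e_m`: it is
`n_1 + … + n_{j-1} + i` with `2 ≤ i ≤ n_j + 1` when `i` and `j` are counted as usual. -/
def pos {k : ℕ} (n : Fin k → ℕ) (j : Fin k) (i : ℕ) : ℕ :=
  (∑ l ∈ Finset.univ.filter (fun l : Fin k => l < j), n l) + i + 2

/-- The model nilpotent multiplication table on a family
`e_1` (labelled `none`), `e_2, …, e_n` (labelled `some ⟨j, i⟩`): the bracket with `e_1` on the
right shifts every block by one step and kills its last vector; omitted products vanish. -/
structure IsModelTable {k : ℕ} (n : Fin k → ℕ) {L : Type*} [LieRing L]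
    (e : Option (Σ j : Fin k, Fin (n j)) → L) : Prop where
  shift : ∀ (j : Fin k) (i : ℕ) (hi : i + 1 < n j),
    ⁅e (some ⟨j, ⟨i, Nat.lt_of_succ_lt hi⟩⟩), e none⁆ = e (some ⟨j, ⟨i + 1, hi⟩⟩)
  last : ∀ (j : Fin k) (i : Fin (n j)), (i : ℕ) + 1 = n j → ⁅e (some ⟨j, i⟩), e none⁆ = 0
  comm : ∀ p q : Σ j : Fin k, Fin (n j), ⁅e (some p), e (some q)⁆ = 0

/-- `b` is a basis `x_1, …, x_{k+1}, e_1, …, e_n` of the Lie algebra `L` in which the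
multiplication of `L` is the table of `L_{k+1}(N)`, where `N` is the model nilpotent Lie algebra
spanned by `e_1, …, e_n`, with blocks of lengths `n_1, …, n_k`. -/
structure IsMaxSolvable {k : ℕ} (n : Fin k → ℕ) {K L : Type*} [Field K] [LieRing L]
    [LieAlgebra K L] (b : Basis (Idx n) K L) : Prop where
  /-- the `e`'s multiply as in the model nilpotent Lie algebra -/
  model : IsModelTable n (fun p => b (Sum.inr p))
  /-- `[e_1, x_1] = e_1` -/
  e₁_x₁ : ⁅b (e₁ n), b (xi n 0)⁆ = b (e₁ n)
  /-- `[e_m, x_1] = m e_m` for `m ≥ 2` -/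
  e_x₁ : ∀ (j : Fin k) (i : Fin (n j)),
    ⁅b (ei n j i), b (xi n 0)⁆ = (pos n j i : K) • b (ei n j i)
  /-- `[e_1, x_{j+1}] = 0` for `1 ≤ j ≤ k` -/
  e₁_x : ∀ j : Fin k, ⁅b (e₁ n), b (xi n j.succ)⁆ = 0
  /-- `[e_m, x_{j+1}] = e_m` if `e_m` lies in the `j`-th block -/
  e_x_same : ∀ (j : Fin k) (i : Fin (n j)), ⁅b (ei n j i), b (xi n j.succ)⁆ = b (ei n j i)
  /-- `[e_m, x_{j+1}] = 0` if `e_m` lies in another block -/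
  e_x_other : ∀ (j j' : Fin k) (i : Fin (n j)), j ≠ j' → ⁅b (ei n j i), b (xi n j'.succ)⁆ = 0
  /-- the `x`'s commute -/
  x_x : ∀ j j' : Fin (k + 1), ⁅b (xi n j), b (xi n j')⁆ = 0

/-- A linear operator `Δ` is a local derivation if at every point it agrees with some derivation
(depending on the point). -/
def IsLocalDerivation {K L : Type*} [Field K] [LieRing L] [LieAlgebra K L]
    (Δ : L →ₗ[K] L) : Prop :=
  ∀ x : L, ∃ d : LieDerivation K L L, Δ x = d x

/-! The table does define a Lie algebra: coordinates, bracket, Jacobi identity. -/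

/-- The space of coordinate vectors with respect to `x_1, …, x_{k+1}, e_1, …, e_n`. -/
def Coord (K : Type*) {k : ℕ} (n : Fin k → ℕ) : Type _ := Idx n → K

variable {K : Type*} [Field K] {k : ℕ} {n : Fin k → ℕ}

noncomputable instance : AddCommGroup (Coord K n) := inferInstanceAs (AddCommGroup (Idx n → K))
noncomputable instance : Module K (Coord K n) := inferInstanceAs (Module K (Idx n → K))

/-- Coordinate of the predecessor in the block, `0` at the first vector. -/
def prev (u : Coord K n) (j : Fin k) : (i : ℕ) → i < n j → K
  | 0, _ => 0
  | i + 1, h => u (ei n j ⟨i, Nat.lt_of_succ_lt h⟩)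

/-- The bilinear extension of the table. -/
def brk (u v : Coord K n) : Coord K n
  | Sum.inl _ => 0
  | Sum.inr none => u (e₁ n) * v (xi n 0) - v (e₁ n) * u (xi n 0)
  | Sum.inr (some ⟨j, i⟩) =>
      (pos n j i : K) * (u (ei n j i) * v (xi n 0) - v (ei n j i) * u (xi n 0))
      + (u (ei n j i) * v (xi n j.succ) - v (ei n j i) * u (xi n j.succ))
      + (prev u j i i.2 * v (e₁ n) - prev v j i i.2 * u (e₁ n))

theorem coord_add (u v : Coord K n) (p : Idx n) : (u + v) p = u p + v p := rfl
theorem coord_smul (c : K) (v : Coord K n) (p : Idx n) : (c • v) p = c * v p := rfl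
theorem coord_zero (p : Idx n) : (0 : Coord K n) p = 0 := rfl

theorem prev_add (u v : Coord K n) (j : Fin k) (i : ℕ) (h : i < n j) :
    prev (u + v) j i h = prev u j i h + prev v j i h := by
  cases i <;> simp [prev, coord_add]

theorem prev_smul (c : K) (v : Coord K n) (j : Fin k) (i : ℕ) (h : i < n j) :
    prev (c • v) j i h = c * prev v j i h := by
  cases i <;> simp [prev, coord_smul]

noncomputable instance : LieRing (Coord K n) where
  bracket := brk
  add_lie u v w := by
    funext p
    rcases p with j | _ | ⟨j, i⟩ <;>
      simp only [brk, coord_add, prev_add] <;> ring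
  lie_add u v w := by
    funext p
    rcases p with j | _ | ⟨j, i⟩ <;>
      simp only [brk, coord_add, prev_add] <;> ring
  lie_self u := by
    funext p
    rcases p with j | _ | ⟨j, i⟩ <;>
      simp only [brk, coord_zero] <;> ring
  leibniz_lie u v w := by
    funext p
    rcases p with j | _ | ⟨j, ⟨i, hi⟩⟩
    · simp [brk, coord_add]
    · simp only [brk, coord_add]; ring
    · rcases i with _ | _ | i <;>
        simp only [brk, coord_add, prev, pos] <;> push_cast <;> ring

theorem lie_def (u v : Coord K n) : ⁅u, v⁆ = brk u v := rfl

noncomputable instance : LieAlgebra K (Coord K n) where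
  lie_smul c u v := by
    funext p
    rcases p with j | _ | ⟨j, i⟩ <;>
      simp only [lie_def, brk, coord_smul, prev_smul] <;> ring

/-- The standard basis of the coordinate space. -/
noncomputable def stdBasis (K : Type*) [Field K] {k : ℕ} (n : Fin k → ℕ) :
    Basis (Idx n) K (Coord K n) := Pi.basisFun K (Idx n)

theorem stdBasis_apply (p q : Idx n) : stdBasis K n p q = if q = p then 1 else 0 := by
  have : stdBasis K n p = (Pi.basisFun K (Idx n) p : Idx n → K) := rfl
  rw [this, Pi.basisFun_apply, Pi.single_apply]

/-- The standard basis multiplies by the table, so that `L_{k+1}(N)` exists over every field and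
for all block lengths. -/
theorem isMaxSolvable_stdBasis (K : Type*) [Field K] {k : ℕ} (n : Fin k → ℕ) :
    IsMaxSolvable n (stdBasis K n) := by
  refine ⟨⟨?_, ?_, ?_⟩, ?_, ?_, ?_, ?_, ?_, ?_⟩ <;> intros <;> funext p <;>
    rcases p with l | _ | ⟨l, ⟨_ | m, hm⟩⟩ <;>
    simp only [lie_def, brk, stdBasis_apply, prev, coord_zero, coord_smul] <;> grind

end ModelSolvable


/-! On the torus `T` spanned by the `x`'s a local derivation agrees with an inner one: the
coordinate of `d t` along a weight vector of weight `α` vanishes when `α t = 0`, hence is a multiple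
of `α t`. So we may assume `Δ T = 0`. The other points are reached by moving `T`: for a weight
vector `e_p` the conjugate of `Δ` by `φ = exp (ad e_p)` is again a local derivation, hence inner on
`T`, and `φ t = t + α_p(t) e_p` turns this into `Δ e_p = β_p e_p`, because no other weight is
proportional to `α_p`. Then `φ⁻¹ Δ φ - β_p ad e_p` vanishes on `T` as well, hence is diagonal, and
comparing coordinates gives `β_r = β_p + β_q` whenever `e_r` occurs in `[e_p, e_q]`. As the torus is
maximal, such a `β` is the system of eigenvalues of an element of `T`. -/

namespace ModelSolvable

open Module

section Algebra

theorem isNilpotent_of_commutator_eq_smul {K A : Type*} [Field K] [CharZero K] [Ring A]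
    [Algebra K A] [FiniteDimensional K A] {a h : A} {c : K} (hc : c ≠ 0)
    (hah : h * a - a * h = c • a) : IsNilpotent a := by
  -- The nonzero powers of `a` are eigenvectors of `[h, ·]` with distinct eigenvalues `m c`.
  by_contra ha
  have commutator_pow (m : ℕ) : h * a ^ m - a ^ m * h = (m * c) • a ^ m := by
    induction m with
    | zero => simp
    | succ m ih =>
      calc h * a ^ (m + 1) - a ^ (m + 1) * h
          = (h * a ^ m - a ^ m * h) * a + a ^ m * (h * a - a * h) := by noncomm_ring
        _ = ((m + 1 : ℕ) * c) • a ^ (m + 1) := by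
          rw [ih, hah, smul_mul_assoc, mul_smul_comm, ← pow_succ]
          push_cast
          module
  have eigenvalue (m : ℕ) :
      End.HasEigenvalue (LinearMap.mulLeft K h - LinearMap.mulRight K h) (m * c) :=
    End.hasEigenvalue_of_hasEigenvector (x := a ^ m)
      ⟨End.mem_eigenspace_iff.2 (commutator_pow m), fun h0 => ha ⟨m, h0⟩⟩
  have injective : Function.Injective fun m : ℕ => (m : K) * c :=
    (mul_left_injective₀ hc).comp Nat.cast_injective
  exact Set.infinite_of_injective_forall_mem injective eigenvalue (End.finite_hasEigenvalue _)

theorem isNilpotent_ad_of_lie_eq_smul {K L : Type*} [Field K] [CharZero K] [LieRing L]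
    [LieAlgebra K L] [FiniteDimensional K L] {x t : L} {c : K} (hc : c ≠ 0)
    (hxt : ⁅x, t⁆ = c • x) : IsNilpotent (LieAlgebra.ad K L x) := by
  refine isNilpotent_of_commutator_eq_smul (h := LieAlgebra.ad K L t) (neg_ne_zero.2 hc) ?_
  ext y
  have jacobi : ⁅t, ⁅x, y⁆⁆ - ⁅x, ⁅t, y⁆⁆ = ⁅⁅t, x⁆, y⁆ := (lie_lie t x y).symm
  simpa [← lie_skew t x, hxt] using jacobi

/-- `φ` is the automorphism `exp (ad x)`, given by the exponential series wherever the series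
terminates. -/
def IsExpAd {K L : Type*} [Field K] [LieRing L] [LieAlgebra K L] (x : L) (φ : L ≃ₗ⁅K⁆ L) : Prop :=
  ∀ (y : L) (m : ℕ), (LieAlgebra.ad K L x ^ m) y = 0 →
    φ y = ∑ i ∈ Finset.range m, (i.factorial : K)⁻¹ • (LieAlgebra.ad K L x ^ i) y

theorem exists_isExpAd {K L : Type*} [Field K] [CharZero K] [LieRing L] [LieAlgebra K L] {x : L}
    (hx : IsNilpotent (LieAlgebra.ad K L x)) : ∃ φ : L ≃ₗ⁅K⁆ L, IsExpAd x φ := by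
  let : Module ℚ L := Module.compHom L (algebraMap ℚ K)
  have smul_def (q : ℚ) (y : L) : q • y = (q : K) • y := rfl
  let : LieAlgebra ℚ L := { lie_smul := fun q y z => by rw [smul_def, smul_def, lie_smul] }
  have hx' : IsNilpotent (LieDerivation.ad K L x).toLinearMap := by simpa using hx
  refine ⟨(LieDerivation.ad K L x).exp hx', fun y m hm => ?_⟩
  rw [LieDerivation.exp_map_apply, ← Module.End.smul_def,
    IsNilpotent.exp_smul_eq_sum (k := m) (by simpa using hm) hx']
  simp [smul_def]

namespace IsExpAd

variable {K L : Type*} [Field K] [LieRing L] [LieAlgebra K L] {x : L} {φ : L ≃ₗ⁅K⁆ L}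

theorem apply_self (hφ : IsExpAd x φ) : φ x = x := by
  simpa using hφ x 1 (by simp)

theorem apply_of_lie_eq_smul (hφ : IsExpAd x φ) {t : L} {c : K} (ht : ⁅x, t⁆ = c • x) :
    φ t = t + c • x := by
  simpa [Finset.sum_range_succ, ht] using hφ t 2 (by simp [pow_two, ht])

theorem map_apply (hφ : IsExpAd x φ) (hx : IsNilpotent (LieAlgebra.ad K L x)) (g : L →ₗ[K] K)
    {y : L} {j : ℕ} (hj : ∀ i, i ≠ j → g ((LieAlgebra.ad K L x ^ i) y) = 0) :
    g (φ y) = (j.factorial : K)⁻¹ * g ((LieAlgebra.ad K L x ^ j) y) := by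
  obtain ⟨m, hm⟩ := hx
  have hm' : (LieAlgebra.ad K L x ^ (m + j + 1)) y = 0 := by
    rw [add_assoc, pow_add, hm, zero_mul, LinearMap.zero_apply]
  rw [hφ y _ hm', map_sum, Finset.sum_eq_single j]
  · simp
  · intro i _ hij
    simp [hj i hij]
  · intro hjm
    exact absurd (Finset.mem_range.2 (by omega)) hjm

end IsExpAd

variable {K κ : Type*} [Field K] [Fintype κ]

theorem exists_dotProduct_eq_one {v : κ → K} (hv : v ≠ 0) : ∃ f, v ⬝ᵥ f = 1 := by
  classical
  obtain ⟨a, ha⟩ := Function.ne_iff.1 hv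
  exact ⟨Pi.single a (v a)⁻¹, by simpa using mul_inv_cancel₀ ha⟩

theorem exists_dotProduct_ne_zero_of_notMem_span {v w : κ → K} (hw : w ∉ Submodule.span K {v}) :
    ∃ f, v ⬝ᵥ f = 0 ∧ w ⬝ᵥ f ≠ 0 := by
  classical
  obtain ⟨g, hgw, hgv⟩ := Submodule.exists_le_ker_of_notMem hw
  obtain ⟨f, rfl⟩ := (dotProductEquiv K κ).surjective g
  simp only [Submodule.span_singleton_le_iff_mem, LinearMap.mem_ker, dotProductEquiv_apply_apply]
    at hgv hgw
  exact ⟨f, by rwa [dotProduct_comm], by rwa [dotProduct_comm]⟩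

end Algebra

variable {K L κ ι : Type*} [Field K] [LieRing L] [LieAlgebra K L]

namespace IsLocalDerivation

variable {Δ : L →ₗ[K] L}

theorem conj (hΔ : IsLocalDerivation Δ) (φ : L ≃ₗ⁅K⁆ L) :
    IsLocalDerivation ((φ.symm : L →ₗ[K] L) ∘ₗ Δ ∘ₗ (φ : L →ₗ[K] L)) := by
  intro x
  obtain ⟨d, hd⟩ := hΔ (φ x)
  let d' : LieDerivation K L L :=
    { toLinearMap := (φ.symm : L →ₗ[K] L) ∘ₗ (d : L →ₗ[K] L) ∘ₗ (φ : L →ₗ[K] L)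
      leibniz' := fun u v => by simp [LieEquiv.map_lie, LieDerivation.apply_lie_eq_sub] }
  exact ⟨d', congrArg φ.symm hd⟩

theorem add_ad (hΔ : IsLocalDerivation Δ) (z : L) :
    IsLocalDerivation (Δ + LieAlgebra.ad K L z) := by
  intro x
  obtain ⟨d, hd⟩ := hΔ x
  exact ⟨d + LieDerivation.ad K L z, by simp [hd]⟩

end IsLocalDerivation

variable [Fintype κ]

/-- `α` is a system of weights of the Lie algebra `L` on the basis `b`: the vectors
`b (inl a)` span a torus whose element `∑ a, f a • b (inl a)` multiplies `b (inr p)` by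
`α p ⬝ᵥ f`. The weights are pairwise non-proportional and separate the points of the torus. -/
structure IsWeightBasis (b : Basis (κ ⊕ ι) K L) (α : ι → κ → K) : Prop where
  lie_inl_inl : ∀ a a', ⁅b (.inl a), b (.inl a')⁆ = 0
  lie_inr_inl : ∀ p a, ⁅b (.inr p), b (.inl a)⁆ = α p a • b (.inr p)
  ne_zero : ∀ p, α p ≠ 0
  notMem_span : ∀ p q, p ≠ q → α q ∉ Submodule.span K {α p}
  eq_zero_of_forall_dotProduct_eq_zero : ∀ f, (∀ p, α p ⬝ᵥ f = 0) → f = 0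

/-- The element `∑ a, f a • b (inl a)` of the torus with coordinates `f`. -/
noncomputable def toral (b : Basis (κ ⊕ ι) K L) : (κ → K) →ₗ[K] L :=
  Fintype.linearCombination K (b ∘ Sum.inl)

theorem toral_single [DecidableEq κ] (b : Basis (κ ⊕ ι) K L) (a : κ) :
    toral b (Pi.single a 1) = b (.inl a) := by
  simp [toral]

theorem repr_apply_of_forall_apply_eq_smul {b : Basis (κ ⊕ ι) K L} {Δ : L →ₗ[K] L} {β : ι → K}
    (hΔ₀ : ∀ f, Δ (toral b f) = 0) (hβ : ∀ p, Δ (b (.inr p)) = β p • b (.inr p)) (u : L) (q : ι) :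
    b.repr (Δ u) (.inr q) = β q * b.repr u (.inr q) := by
  have key : b.coord (.inr q) ∘ₗ Δ = β q • b.coord (.inr q) := by
    classical
    refine b.ext ?_
    rintro (a | p)
    · have hinl : Δ (b (.inl a)) = 0 := by rw [← toral_single b a, hΔ₀]
      simp [hinl]
    · rcases eq_or_ne p q with rfl | hpq
      · simp [hβ]
      · simp [hβ, hpq]
  exact LinearMap.congr_fun key u

namespace IsWeightBasis

variable {b : Basis (κ ⊕ ι) K L} {α : ι → κ → K}

theorem lie_toral (h : IsWeightBasis b α) (p : ι) (f : κ → K) :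
    ⁅b (.inr p), toral b f⁆ = (α p ⬝ᵥ f) • b (.inr p) := by
  simp [toral, Fintype.linearCombination_apply, lie_sum, h.lie_inr_inl, smul_smul,
    ← Finset.sum_smul, dotProduct, mul_comm]

theorem toral_lie_toral (h : IsWeightBasis b α) (f g : κ → K) : ⁅toral b f, toral b g⁆ = 0 := by
  simp [toral, Fintype.linearCombination_apply, lie_sum, sum_lie, h.lie_inl_inl]

theorem inl_lie_toral (h : IsWeightBasis b α) (a : κ) (f : κ → K) :
    ⁅b (.inl a), toral b f⁆ = 0 := by
  simp [toral, Fintype.linearCombination_apply, lie_sum, h.lie_inl_inl]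

theorem repr_lie_toral_inl (h : IsWeightBasis b α) (u : L) (f : κ → K) (a : κ) :
    b.repr ⁅u, toral b f⁆ (.inl a) = 0 := by
  have key : b.coord (.inl a) ∘ₗ (-LieAlgebra.ad K L (toral b f)) = 0 := by
    refine b.ext fun i => ?_
    simp only [LinearMap.comp_apply, LinearMap.neg_apply, LieAlgebra.ad_apply, lie_skew]
    cases i <;> simp [h.inl_lie_toral, h.lie_toral]
  simpa only [LinearMap.comp_apply, LinearMap.neg_apply, LieAlgebra.ad_apply, lie_skew,
    b.coord_apply, LinearMap.zero_apply] using LinearMap.congr_fun key u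

theorem repr_lie_toral_inr (h : IsWeightBasis b α) (u : L) (f : κ → K) (q : ι) :
    b.repr ⁅u, toral b f⁆ (.inr q) = (α q ⬝ᵥ f) * b.repr u (.inr q) := by
  have key : b.coord (.inr q) ∘ₗ (-LieAlgebra.ad K L (toral b f)) =
      (α q ⬝ᵥ f) • b.coord (.inr q) := by
    refine b.ext fun i => ?_
    simp only [LinearMap.comp_apply, LinearMap.neg_apply, LieAlgebra.ad_apply, lie_skew]
    rcases i with a | p
    · simp [h.inl_lie_toral]
    · rcases eq_or_ne p q with rfl | hpq
      · simp [h.lie_toral]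
      · simp [h.lie_toral, hpq]
  simpa only [LinearMap.comp_apply, LinearMap.neg_apply, LieAlgebra.ad_apply, lie_skew,
    b.coord_apply, LinearMap.smul_apply, smul_eq_mul] using LinearMap.congr_fun key u

theorem lie_ad_pow_toral (h : IsWeightBasis b α) (p q : ι) (f : κ → K) (i : ℕ) :
    ⁅(LieAlgebra.ad K L (b (.inr p)) ^ i) (b (.inr q)), toral b f⁆ =
      ((α q + (i : K) • α p) ⬝ᵥ f) • (LieAlgebra.ad K L (b (.inr p)) ^ i) (b (.inr q)) := by
  induction i with
  | zero => simp [h.lie_toral]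
  | succ i ih =>
    rw [pow_succ', Module.End.mul_apply, LieAlgebra.ad_apply, lie_lie, ih, h.lie_toral,
      lie_smul, lie_smul, ← lie_skew _ (b (.inr p)), smul_neg, sub_neg_eq_add, ← add_smul]
    congr 1
    simp only [add_dotProduct, smul_dotProduct, smul_eq_mul]
    push_cast
    ring

theorem weight_eq_of_repr_ad_pow_ne_zero (h : IsWeightBasis b α) {p q s : ι} {i : ℕ}
    (hs : b.repr ((LieAlgebra.ad K L (b (.inr p)) ^ i) (b (.inr q))) (.inr s) ≠ 0) :
    α s = α q + (i : K) • α p := by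
  refine dotProduct_eq _ _ fun f => mul_right_cancel₀ hs ?_
  rw [← h.repr_lie_toral_inr, h.lie_ad_pow_toral, map_smul, Finsupp.smul_apply, smul_eq_mul]

theorem repr_ad_pow_eq_zero [CharZero K] (h : IsWeightBasis b α) {p q s : ι} {i j : ℕ}
    (hi : b.repr ((LieAlgebra.ad K L (b (.inr p)) ^ i) (b (.inr q))) (.inr s) ≠ 0) (hij : j ≠ i) :
    b.repr ((LieAlgebra.ad K L (b (.inr p)) ^ j) (b (.inr q))) (.inr s) = 0 := by
  by_contra hj
  have heq : (j : K) • α p = (i : K) • α p := add_left_cancel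
    ((h.weight_eq_of_repr_ad_pow_ne_zero hj).symm.trans (h.weight_eq_of_repr_ad_pow_ne_zero hi))
  exact hij (Nat.cast_injective (smul_left_injective K (h.ne_zero p) heq))

theorem repr_lie_self (h : IsWeightBasis b α) (p : ι) (u : L) :
    b.repr ⁅b (.inr p), u⁆ (.inr p) = α p ⬝ᵥ fun a => b.repr u (.inl a) := by
  have key : b.coord (.inr p) ∘ₗ LieAlgebra.ad K L (b (.inr p)) =
      ∑ a, α p a • b.coord (.inl a) := by
    classical
    refine b.ext ?_
    rintro (a | s)
    · simp [h.lie_inr_inl, Finsupp.single_apply]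
    · suffices hs : b.repr ⁅b (.inr p), b (.inr s)⁆ (.inr p) = 0 by simpa using hs
      by_contra hs
      have weight_eq : α p = α s + ((1 : ℕ) : K) • α p :=
        h.weight_eq_of_repr_ad_pow_ne_zero (by simpa using hs)
      exact h.ne_zero s (by simpa using weight_eq)
  simpa [dotProduct] using LinearMap.congr_fun key u

theorem repr_derivation_toral_inl (h : IsWeightBasis b α) (d : LieDerivation K L L) (f : κ → K)
    (a : κ) : b.repr (d (toral b f)) (.inl a) = 0 := by
  suffices hzero : (fun a => b.repr (d (toral b f)) (.inl a)) = 0 from congrFun hzero a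
  refine h.eq_zero_of_forall_dotProduct_eq_zero _ fun p => ?_
  have leibniz : ⁅b (.inr p), d (toral b f)⁆ + ⁅d (b (.inr p)), toral b f⁆ =
      (α p ⬝ᵥ f) • d (b (.inr p)) := by
    rw [← d.apply_lie_eq_add, h.lie_toral, map_smul]
  have coord := congrArg (fun y => b.repr y (.inr p)) leibniz
  simpa [h.repr_lie_self, h.repr_lie_toral_inr] using coord

theorem repr_derivation_toral_inr (h : IsWeightBasis b α) (d : LieDerivation K L L) {f : κ → K}
    {q : ι} (hf : α q ⬝ᵥ f = 0) : b.repr (d (toral b f)) (.inr q) = 0 := by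
  obtain ⟨f₀, hf₀⟩ := exists_dotProduct_eq_one (h.ne_zero q)
  have leibniz : ⁅d (toral b f), toral b f₀⁆ = ⁅d (toral b f₀), toral b f⁆ := by
    have hzero := d.apply_lie_eq_add (toral b f) (toral b f₀)
    rw [h.toral_lie_toral, map_zero, ← lie_skew (toral b f)] at hzero
    exact (neg_add_eq_zero.1 hzero.symm).symm
  have coord := congrArg (fun y => b.repr y (.inr q)) leibniz
  simpa [h.repr_lie_toral_inr, hf, hf₀] using coord

variable {Δ : L →ₗ[K] L}

theorem exists_toral_eq_lie [Finite ι] (h : IsWeightBasis b α) (hΔ : IsLocalDerivation Δ) :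
    ∃ z, ∀ f, Δ (toral b f) = ⁅toral b f, z⁆ := by
  choose g hg using fun q => exists_dotProduct_eq_one (h.ne_zero q)
  have coord_inr (q : ι) (f : κ → K) :
      b.repr (Δ (toral b f)) (.inr q) = (α q ⬝ᵥ f) * b.repr (Δ (toral b (g q))) (.inr q) := by
    obtain ⟨d, hd⟩ := hΔ (toral b (f - (α q ⬝ᵥ f) • g q))
    have hzero := h.repr_derivation_toral_inr d (q := q) (f := f - (α q ⬝ᵥ f) • g q)
      (by simp [dotProduct_sub, hg])
    rw [← hd] at hzero
    simpa [sub_eq_zero] using hzero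
  have coord_inl (a : κ) (f : κ → K) : b.repr (Δ (toral b f)) (.inl a) = 0 := by
    obtain ⟨d, hd⟩ := hΔ (toral b f)
    rw [hd, h.repr_derivation_toral_inl]
  have := Fintype.ofFinite ι
  refine ⟨-∑ q, b.repr (Δ (toral b (g q))) (.inr q) • b (.inr q), fun f => b.ext_elem ?_⟩
  rw [lie_neg, lie_skew]
  rintro (a | q)
  · rw [coord_inl, h.repr_lie_toral_inl]
  · rw [coord_inr, h.repr_lie_toral_inr]
    classical
    simp [Finsupp.single_apply]

variable [CharZero K] [Finite ι]

theorem isNilpotent_ad (h : IsWeightBasis b α) (p : ι) :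
    IsNilpotent (LieAlgebra.ad K L (b (.inr p))) := by
  have := Module.Finite.of_basis b
  obtain ⟨f, hf⟩ := exists_dotProduct_eq_one (h.ne_zero p)
  exact isNilpotent_ad_of_lie_eq_smul (hf.trans_ne one_ne_zero) (h.lie_toral p f)

theorem exists_apply_eq_smul (h : IsWeightBasis b α) (hΔ : IsLocalDerivation Δ)
    (hΔ₀ : ∀ f, Δ (toral b f) = 0) (p : ι) : ∃ c : K, Δ (b (.inr p)) = c • b (.inr p) := by
  obtain ⟨φ, hφ⟩ := exists_isExpAd (h.isNilpotent_ad p)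
  obtain ⟨z, hz⟩ := h.exists_toral_eq_lie (hΔ.conj φ)
  have apply_eq (f : κ → K) : (α p ⬝ᵥ f) • Δ (b (.inr p)) = φ ⁅toral b f, z⁆ := by
    rw [← hz]
    simp [hφ.apply_of_lie_eq_smul (h.lie_toral p f), hΔ₀]
  have repr_z (q : ι) (hqp : q ≠ p) : b.repr z (.inr q) = 0 := by
    obtain ⟨f, hpf, hqf⟩ := exists_dotProduct_ne_zero_of_notMem_span (h.notMem_span p q hqp.symm)
    have hlie : ⁅z, toral b f⁆ = 0 := by
      rw [← lie_skew, neg_eq_zero]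
      exact (map_eq_zero_iff φ φ.injective).1 (by rw [← apply_eq, hpf, zero_smul])
    have hmul := h.repr_lie_toral_inr z f q
    rw [hlie, map_zero, Finsupp.zero_apply] at hmul
    exact (mul_eq_zero.1 hmul.symm).resolve_left hqf
  obtain ⟨f, hf⟩ := exists_dotProduct_eq_one (h.ne_zero p)
  have hlie : ⁅z, toral b f⁆ = b.repr z (.inr p) • b (.inr p) := by
    refine b.ext_elem ?_
    rintro (a | q)
    · simp [h.repr_lie_toral_inl]
    · rcases eq_or_ne q p with rfl | hqp
      · simp [h.repr_lie_toral_inr, hf]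
      · simp [h.repr_lie_toral_inr, repr_z q hqp, hqp.symm]
  refine ⟨-b.repr z (.inr p), ?_⟩
  rw [← one_smul K (Δ _), ← hf, apply_eq, ← lie_skew, hlie, map_neg, map_smul, hφ.apply_self,
    neg_smul]

theorem exists_apply_exp_eq (h : IsWeightBasis b α) (hΔ : IsLocalDerivation Δ)
    (hΔ₀ : ∀ f, Δ (toral b f) = 0) {p : ι} {c : K} (hp : Δ (b (.inr p)) = c • b (.inr p))
    {φ : L ≃ₗ⁅K⁆ L} (hφ : IsExpAd (b (.inr p)) φ) (q : ι) :
    ∃ c' : K, Δ (φ (b (.inr q))) = c' • φ (b (.inr q)) + c • φ ⁅b (.inr p), b (.inr q)⁆ := by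
  -- `φ⁻¹ Δ φ` agrees on the torus with the inner derivation `c • ad e_p`.
  have conj_toral (f : κ → K) : φ.symm (Δ (φ (toral b f))) = ((α p ⬝ᵥ f) * c) • b (.inr p) := by
    have symm_apply : φ.symm (b (.inr p)) = b (.inr p) := φ.symm_apply_eq.2 hφ.apply_self.symm
    simp [hφ.apply_of_lie_eq_smul (h.lie_toral p f), hΔ₀, hp, symm_apply, smul_smul]
  obtain ⟨c', hc'⟩ := h.exists_apply_eq_smul ((hΔ.conj φ).add_ad (-(c • b (.inr p))))
    (fun f => by simp [conj_toral, h.lie_toral, smul_smul, mul_comm]) q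
  have conj_apply : φ.symm (Δ (φ (b (.inr q)))) =
      c' • b (.inr q) + c • ⁅b (.inr p), b (.inr q)⁆ := by
    simp [← hc']
  exact ⟨c', by rw [φ.symm_apply_eq.1 conj_apply, map_add, map_smul, map_smul]⟩

theorem eigenvalue_eq_add (h : IsWeightBasis b α) (hΔ : IsLocalDerivation Δ)
    (hΔ₀ : ∀ f, Δ (toral b f) = 0) {β : ι → K} (hβ : ∀ p, Δ (b (.inr p)) = β p • b (.inr p))
    {p q r : ι} (hpq : b.repr ⁅b (.inr p), b (.inr q)⁆ (.inr r) ≠ 0) : β r = β p + β q := by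
  have hnil := h.isNilpotent_ad p
  obtain ⟨φ, hφ⟩ := exists_isExpAd hnil
  obtain ⟨c, hc⟩ := h.exists_apply_exp_eq hΔ hΔ₀ (hβ p) hφ q
  have coord (s : ι) : β s * b.repr (φ (b (.inr q))) (.inr s) =
      c * b.repr (φ (b (.inr q))) (.inr s) +
        β p * b.repr (φ ⁅b (.inr p), b (.inr q)⁆) (.inr s) := by
    simp [← repr_apply_of_forall_apply_eq_smul hΔ₀ hβ, hc]
  have repr_q (j : ℕ) (hj : j ≠ 0) :
      b.coord (.inr q) ((LieAlgebra.ad K L (b (.inr p)) ^ j) (b (.inr q))) = 0 :=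
    h.repr_ad_pow_eq_zero (i := 0) (by simp) hj
  have repr_r (j : ℕ) (hj : j ≠ 1) :
      b.coord (.inr r) ((LieAlgebra.ad K L (b (.inr p)) ^ j) (b (.inr q))) = 0 :=
    h.repr_ad_pow_eq_zero (i := 1) (by simpa using hpq) hj
  have exp_q : b.repr (φ (b (.inr q))) (.inr q) = 1 := by
    simpa using hφ.map_apply hnil _ repr_q
  have exp_r : b.repr (φ (b (.inr q))) (.inr r) = b.repr ⁅b (.inr p), b (.inr q)⁆ (.inr r) := by
    simpa using hφ.map_apply hnil _ repr_r
  have exp_lie_q : b.repr (φ ⁅b (.inr p), b (.inr q)⁆) (.inr q) = 0 := by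
    have lie_q : b.coord (.inr q) ⁅b (.inr p), b (.inr q)⁆ = 0 := by
      simpa using repr_q 1 one_ne_zero
    simpa [lie_q] using hφ.map_apply hnil (b.coord (.inr q)) (y := ⁅b (.inr p), b (.inr q)⁆)
      (j := 0) fun i _ => repr_q (i + 1) i.succ_ne_zero
  have exp_lie_r : b.repr (φ ⁅b (.inr p), b (.inr q)⁆) (.inr r) =
      b.repr ⁅b (.inr p), b (.inr q)⁆ (.inr r) := by
    simpa using hφ.map_apply hnil (b.coord (.inr r)) (j := 0) fun i hi =>
      repr_r (i + 1) (by simpa using hi)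
  have coord_q : β q = c := by simpa [exp_q, exp_lie_q] using coord q
  have coord_r := coord r
  rw [exp_r, exp_lie_r, ← coord_q, ← add_mul] at coord_r
  rw [mul_right_cancel₀ hpq coord_r, add_comm]

end IsWeightBasis

section ModelNilradical

variable {K : Type*} [Field K] {k : ℕ} {n : Fin k → ℕ}

/-- The weights of `L_{k+1}(N)` on the basis `e_1, …, e_n` of its nilradical: the coordinate `l` of
`weight K n p` is the eigenvalue of `y ↦ ⁅y, b (xi n l)⁆` on `b (inr p)`. -/
def weight (K : Type*) [Field K] {k : ℕ} (n : Fin k → ℕ) :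
    Option (Σ j : Fin k, Fin (n j)) → Fin (k + 1) → K
  | none => Fin.cons 1 0
  | some ⟨j, i⟩ => Fin.cons (pos n j i) (Pi.single j 1)

theorem pos_succ (n : Fin k → ℕ) (j : Fin k) (i : ℕ) : pos n j (i + 1) = pos n j i + 1 := by
  simp only [pos]
  omega

theorem weight_ne_zero (p : Option (Σ j : Fin k, Fin (n j))) : weight K n p ≠ 0 := by
  intro h
  rcases p with _ | ⟨j, i⟩
  · simpa [weight] using congrFun h 0
  · simpa [weight] using congrFun h j.succ

theorem weight_notMem_span [CharZero K] {p q : Option (Σ j : Fin k, Fin (n j))} (hpq : p ≠ q) :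
    weight K n q ∉ Submodule.span K {weight K n p} := by
  rw [Submodule.mem_span_singleton]
  rintro ⟨c, hc⟩
  have hc₀ := congrFun hc 0
  have hc_succ (l : Fin k) := congrFun hc l.succ
  rcases p with _ | ⟨j, i⟩ <;> rcases q with _ | ⟨j', i'⟩
  · exact hpq rfl
  · simpa [weight] using hc_succ j'
  · have hc_zero : c = 0 := by simpa [weight] using hc_succ j
    simp [weight, hc_zero] at hc₀
  · have hjj' : j = j' := by
      by_contra hne
      simpa [weight, hne] using hc_succ j'
    subst hjj'
    have hc_one : c = 1 := by simpa [weight] using hc_succ j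
    have hpos : i = i' := by simpa [weight, hc_one, pos, Fin.ext_iff] using hc₀
    exact hpq (by rw [hpos])

theorem weight_none_dotProduct (f : Fin (k + 1) → K) : weight K n none ⬝ᵥ f = f 0 := by
  simp [weight, dotProduct, Fin.sum_univ_succ]

theorem weight_some_dotProduct (j : Fin k) (i : Fin (n j)) (f : Fin (k + 1) → K) :
    weight K n (some ⟨j, i⟩) ⬝ᵥ f = pos n j i * f 0 + f j.succ := by
  simp [weight, dotProduct, Fin.sum_univ_succ, Pi.single_apply]

theorem eq_zero_of_forall_weight_dotProduct_eq_zero (hn : ∀ j, 1 ≤ n j) {f : Fin (k + 1) → K}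
    (hf : ∀ p, weight K n p ⬝ᵥ f = 0) : f = 0 := by
  have hf₀ : f 0 = 0 := by simpa only [weight_none_dotProduct] using hf none
  refine funext (Fin.cases hf₀ fun j => ?_)
  simpa [weight_some_dotProduct, hf₀] using hf (some ⟨j, ⟨0, hn j⟩⟩)

theorem IsMaxSolvable.isWeightBasis [CharZero K] (hn : ∀ j, 1 ≤ n j) {L : Type*} [LieRing L]
    [LieAlgebra K L] {b : Basis (Idx n) K L} (hb : IsMaxSolvable n b) :
    IsWeightBasis b (weight K n) where
  lie_inl_inl := hb.x_x
  lie_inr_inl p a := by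
    rcases p with _ | ⟨j, i⟩ <;> refine Fin.cases ?_ (fun j' => ?_) a
    · simpa [weight] using hb.e₁_x₁
    · simpa [weight] using hb.e₁_x j'
    · simpa [weight] using hb.e_x₁ j i
    · rcases eq_or_ne j j' with rfl | hjj'
      · simpa [weight] using hb.e_x_same j i
      · simpa [weight, hjj'.symm] using hb.e_x_other j j' i hjj'
  ne_zero := weight_ne_zero
  notMem_span _ _ := weight_notMem_span
  eq_zero_of_forall_dotProduct_eq_zero _ := eq_zero_of_forall_weight_dotProduct_eq_zero hn

theorem IsMaxSolvable.exists_eq_weight_dotProduct (hn : ∀ j, 1 ≤ n j) {L : Type*} [LieRing L]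
    [LieAlgebra K L] {b : Basis (Idx n) K L} (hb : IsMaxSolvable n b)
    {β : Option (Σ j : Fin k, Fin (n j)) → K}
    (hβ : ∀ p q r, b.repr ⁅b (.inr p), b (.inr q)⁆ (.inr r) ≠ 0 → β r = β p + β q) :
    ∃ f, ∀ p, β p = weight K n p ⬝ᵥ f := by
  have shift (j : Fin k) (i : ℕ) (hi : i + 1 < n j) :
      β (some ⟨j, ⟨i + 1, hi⟩⟩) = β (some ⟨j, ⟨i, by omega⟩⟩) + β none :=
    hβ _ _ _ (by rw [hb.model.shift j i hi]; simp)
  refine ⟨Fin.cons (β none) fun j => β (some ⟨j, ⟨0, hn j⟩⟩) - pos n j 0 * β none, ?_⟩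
  rintro (_ | ⟨j, i, hi⟩)
  · simp [weight_none_dotProduct]
  · suffices β (some ⟨j, ⟨i, hi⟩⟩) = pos n j i * β none +
        (β (some ⟨j, ⟨0, hn j⟩⟩) - pos n j 0 * β none) by
      simpa [weight_some_dotProduct] using this
    induction i with
    | zero => ring
    | succ i ih =>
      rw [shift, ih, pos_succ]
      push_cast
      ring

end ModelNilradical

end ModelSolvable

/-- The hypothesis `hmax` says that the torus is maximal: every derivation that is diagonal on the
weight vectors comes from it. -/
theorem theorem4p3_general {K L κ ι : Type*} [Field K] [CharZero K] [LieRing L] [LieAlgebra K L]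
    [Fintype κ] [Finite ι] {b : Module.Basis (κ ⊕ ι) K L} {α : ι → κ → K}
    (h : ModelSolvable.IsWeightBasis b α)
    (hmax : ∀ β : ι → K,
      (∀ p q r, b.repr ⁅b (.inr p), b (.inr q)⁆ (.inr r) ≠ 0 → β r = β p + β q) →
        ∃ f, ∀ p, β p = α p ⬝ᵥ f)
    (Δ : L →ₗ[K] L) (hΔ : ModelSolvable.IsLocalDerivation Δ) :
    (∃ D : LieDerivation K L L, ∀ y : L, D y = Δ y) ∧ ∃ z : L, ∀ y : L, Δ y = ⁅y, z⁆ := by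
  suffices inner : ∃ z : L, ∀ y : L, Δ y = ⁅y, z⁆ by
    obtain ⟨z, hz⟩ := inner
    exact ⟨⟨-LieDerivation.ad K L z, fun y => by simp [hz]⟩, z, hz⟩
  obtain ⟨z, hz⟩ := h.exists_toral_eq_lie hΔ
  have vanishes (f : κ → K) : (Δ + LieAlgebra.ad K L z) (ModelSolvable.toral b f) = 0 := by
    rw [LinearMap.add_apply, hz, LieAlgebra.ad_apply, ← lie_skew, neg_add_cancel]
  choose β hβ using h.exists_apply_eq_smul (hΔ.add_ad z) vanishes
  obtain ⟨f, hf⟩ := hmax β fun p q r => h.eigenvalue_eq_add (hΔ.add_ad z) vanishes hβ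
  have key : Δ + LieAlgebra.ad K L z = -LieAlgebra.ad K L (ModelSolvable.toral b f) := by
    classical
    refine b.ext ?_
    rintro (a | p)
    · rw [← ModelSolvable.toral_single b a, vanishes, LinearMap.neg_apply, LieAlgebra.ad_apply,
        h.toral_lie_toral, neg_zero]
    · rw [hβ, hf, ← h.lie_toral, LinearMap.neg_apply, LieAlgebra.ad_apply, lie_skew]
  refine ⟨z + ModelSolvable.toral b f, fun y => ?_⟩
  rw [eq_sub_of_add_eq key, LinearMap.sub_apply, LinearMap.neg_apply, LieAlgebra.ad_apply,
    LieAlgebra.ad_apply, lie_skew, sub_eq_add_neg, lie_skew, lie_add, add_comm]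

theorem theorem4p3 {K : Type*} [Field K] [CharZero K] {k : ℕ} (n : Fin k → ℕ)
    (hn : ∀ j, 1 ≤ n j) {L : Type*} [LieRing L] [LieAlgebra K L]
    (b : Module.Basis (ModelSolvable.Idx n) K L) (hb : ModelSolvable.IsMaxSolvable n b)
    (Δ : L →ₗ[K] L) (hΔ : ModelSolvable.IsLocalDerivation Δ) :
    (∃ D : LieDerivation K L L, ∀ y : L, D y = Δ y) ∧ ∃ z : L, ∀ y : L, Δ y = ⁅y, z⁆ :=
  theorem4p3_general (hb.isWeightBasis hn) (fun _ => hb.exists_eq_weight_dotProduct hn) Δ hΔ
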